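/- Let $X$ be a commutative hypergroup (a locally compact Hausdorff space with convolution $*$, involution $\check{\ }$ and identity $o$, in the sense of Jewett, as in Bloom--Heyer), and for $h\in\mathcal C(X)$, the space of continuous functions $X\to\mathbb C$, write $h(x*y)=\int_X h\,d(\delta_x*\delta_y)$. Suppose that $X$ is a polynomial hypergroup: for some integer $d\ge 1$ there are a probability measure $\pi$ on $\mathbb C^d$ and complex polynomials $Q_x$ $(x\in X)$ in $d$ variables such that - for each $n\ge 0$, the $Q_x$ of degree at most $n$ form a basis of the space of polynomials of degree at most $n$; - $Q_x(1,\dots,1)=1$ for all $x\in X$; - $Q_{\check x}(z)=\overline{Q_x(z)}$ for all $x\in X$, $z\in\operatorname{supp}\pi$; - $Q_xQ_yQ_w$ is $\pi$-integrable and $\int Q_xQ_yQ_w\,d\pi\ge 0$ for all $x,y,w\in X$; - $\delta_x*\delta_y=\sum_{w}c(x,y,w)\,\delta_w$ for all $x,y\in X$, where $Q_xQ_y=\sum_w c(x,y,w)Q_w$. A variety is a linear subspace of $\mathcal C(X)$ that is closed under uniform convergence on compact sets and contains, with each $h$, all translates $x\mapsto h(x*y)$, $y\in X$. The variety $\tau(f)$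 of $f\in\mathcal C(X)$ is the intersection of all varieties containing $f$. The function $f$ is an exponential polynomial if $\tau(f)$ is finite dimensional, and an exponential monomial if moreover $\tau(f)$ is not the sum of two proper subvarieties. A moment function is a member of a family $(f_\alpha)_{\alpha\in\mathbb N^r}$ in $\mathcal C(X)$, for some integer $r\ge 1$, such that $f_{0}\neq 0$ and $$f_\alpha(x*y)=\sum_{\beta\le\alpha}\binom{\alpha}{\beta}f_\beta(x)f_{\alpha-\beta}(y)\qquad(\alpha\in\mathbb N^r,\ x,y\in X).$$ Then every exponential polynomial $f$ on $X$ is a (finite) linear combination of moment functions contained in $\tau(f)$. In particular, this holds for every exponential monomial $f$. -/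

import Mathlib

open MeasureTheory
open scoped NNReal ENNReal ComplexConjugate BoundedContinuousFunction

/-- A commutative hypergroup structure on a locally compact Hausdorff space `X`.
The convolution of bounded regular measures is determined by the convolutions
`conv x y = δ_x * δ_y` of point masses through
`∫ f d(μ * ν) = ∫ ∫ (∫ f d(δ_x * δ_y)) dμ(x) dν(y)`; the axioms are stated for point masses. -/
structure CommHypergroup (X : Type*) [TopologicalSpace X] [T2Space X] [LocallyCompactSpace X]
    [MeasurableSpace X] [BorelSpace X] where
  /-- `δ_x * δ_y`, a probability measure -/
  conv : X → X → ProbabilityMeasure X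
  /-- the identity element `o` -/
  one : X
  /-- the involution `x ↦ x̌` -/
  inv : X → X
  regular_conv : ∀ x y, (conv x y : Measure X).Regular
  isCompact_support_conv : ∀ x y, IsCompact (conv x y : Measure X).support
  /-- joint continuity of `(x, y) ↦ δ_x * δ_y` for the weak topology of probability measures -/
  continuous_conv : Continuous fun p : X × X => conv p.1 p.2
  /-- continuity of `(x, y) ↦ supp (δ_x * δ_y)` for the Michael (Vietoris) topology, whose subbasic
  open sets are given by the compact sets that meet, respectively lie in, an open set `U` -/
  isOpen_support_inter : ∀ U : Set X, IsOpen U →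
    IsOpen {p : X × X | ((conv p.1 p.2 : Measure X).support ∩ U).Nonempty}
  isOpen_support_subset : ∀ U : Set X, IsOpen U →
    IsOpen {p : X × X | (conv p.1 p.2 : Measure X).support ⊆ U}
  /-- associativity `(δ_x * δ_y) * δ_z = δ_x * (δ_y * δ_z)`, tested on bounded continuous
  functions -/
  conv_assoc : ∀ (x y z : X) (f : X →ᵇ ℝ),
    ∫ t, (∫ s, f s ∂(conv t z : Measure X)) ∂(conv x y : Measure X) =
      ∫ t, (∫ s, f s ∂(conv x t : Measure X)) ∂(conv y z : Measure X)
  conv_comm : ∀ x y, conv x y = conv y x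
  one_conv : ∀ x, (conv one x : Measure X) = Measure.dirac x
  continuous_inv : Continuous inv
  inv_inv : ∀ x, inv (inv x) = x
  /-- `(δ_x * δ_y)ˇ = δ_y̌ * δ_x̌` -/
  map_inv_conv : ∀ x y, (conv x y : Measure X).map inv = (conv (inv y) (inv x) : Measure X)
  one_mem_support_iff : ∀ x y, one ∈ (conv x y : Measure X).support ↔ x = inv y

namespace CommHypergroup

variable {X : Type*} [TopologicalSpace X] [T2Space X] [LocallyCompactSpace X]
  [MeasurableSpace X] [BorelSpace X] (H : CommHypergroup X)

/-- `h(x * y) = ∫ h d(δ_x * δ_y)` -/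
noncomputable def eval (h : C(X, ℂ)) (x y : X) : ℂ :=
  ∫ t, h t ∂(H.conv x y : Measure X)

/-- A variety: a translation invariant linear subspace of `C(X)`, closed for uniform convergence
on compact sets (`C(X, ℂ)` carries the compact-open topology). -/
structure IsVariety (V : Submodule ℂ C(X, ℂ)) : Prop where
  isClosed : IsClosed (V : Set C(X, ℂ))
  translate_mem : ∀ h ∈ V, ∀ y : X, ∃ g ∈ V, ∀ x : X, g x = H.eval h x y

/-- The variety `τ(h)` of `h`: the intersection of all varieties that contain `h`. -/
noncomputable def variety (h : C(X, ℂ)) : Submodule ℂ C(X, ℂ) :=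
  sInf {V | H.IsVariety V ∧ h ∈ V}

/-- An exponential polynomial: its variety is finite dimensional. -/
def IsExponentialPolynomial (f : C(X, ℂ)) : Prop :=
  FiniteDimensional ℂ (H.variety f)

/-- An exponential monomial: an exponential polynomial whose variety is indecomposable, that is,
not the sum of two proper subvarieties. -/
def IsExponentialMonomial (f : C(X, ℂ)) : Prop :=
  H.IsExponentialPolynomial f ∧
    ¬ ∃ V W : Submodule ℂ C(X, ℂ), H.IsVariety V ∧ H.IsVariety W ∧
      V < H.variety f ∧ W < H.variety f ∧ V ⊔ W = H.variety f

/-- A generalized moment sequence of rank `r`, indexed by multi-indices in `ℕ^r`. -/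
structure IsMomentSequence (r : ℕ) (f : (Fin r → ℕ) → C(X, ℂ)) : Prop where
  zero_ne : f 0 ≠ 0
  eval_eq : ∀ (α : Fin r → ℕ) (x y : X),
    H.eval (f α) x y =
      ∑ β ∈ Finset.Iic α, ((∏ i, (α i).choose (β i) : ℕ) : ℂ) * f β x * f (α - β) y

/-- A (generalized) moment function: a member of a moment sequence of some positive rank. -/
def IsMomentFunction (g : C(X, ℂ)) : Prop :=
  ∃ r : ℕ, 0 < r ∧ ∃ f : (Fin r → ℕ) → C(X, ℂ), H.IsMomentSequence r f ∧ ∃ α, g = f α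

/-- The hypergroup is associated with the family `Q` of polynomials in `d` variables, with
respect to the probability measure `π` on `ℂ^d`. -/
structure IsAssociatedWith (d : ℕ) (π : Measure (Fin d → ℂ))
    (Q : X → MvPolynomial (Fin d) ℂ) : Prop where
  /-- the `Q x` of total degree at most `n` form a basis of the polynomials of total degree at
  most `n` -/
  linearIndependent : ∀ n : ℕ,
    LinearIndependent ℂ fun x : {x : X // (Q x).totalDegree ≤ n} => Q x
  span_eq : ∀ n : ℕ,
    Submodule.span ℂ (Q '' {x | (Q x).totalDegree ≤ n}) =
      MvPolynomial.restrictTotalDegree (Fin d) ℂ n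
  eval_one : ∀ x, MvPolynomial.eval (fun _ => 1) (Q x) = 1
  eval_inv : ∀ x, ∀ z ∈ π.support,
    MvPolynomial.eval z (Q (H.inv x)) = conj (MvPolynomial.eval z (Q x))
  integrable : ∀ x y w, Integrable (fun z => MvPolynomial.eval z (Q x * Q y * Q w)) π
  integral_re_nonneg : ∀ x y w, 0 ≤ (∫ z, MvPolynomial.eval z (Q x * Q y * Q w) ∂π).re
  integral_im_eq_zero : ∀ x y w, (∫ z, MvPolynomial.eval z (Q x * Q y * Q w) ∂π).im = 0
  /-- `Q_x Q_y = ∑ c(x,y,w) Q_w` and `δ_x * δ_y = ∑ c(x,y,w) δ_w` with the same (finitely many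
  nonzero) coefficients, which are then nonnegative since `δ_x * δ_y` is a positive measure -/
  linearization : ∀ x y, ∃ c : X →₀ ℝ≥0,
    Q x * Q y = ∑ w ∈ c.support, MvPolynomial.C ((c w : ℝ) : ℂ) * Q w ∧
    (H.conv x y : Measure X) = ∑ w ∈ c.support, (c w : ℝ≥0∞) • Measure.dirac w

/-- A polynomial hypergroup (in `d ≥ 1` variables, for some `d`). -/
def IsPolynomialHypergroup : Prop :=
  ∃ d : ℕ, 0 < d ∧ ∃ π : Measure (Fin d → ℂ), IsProbabilityMeasure π ∧
    ∃ Q : X → MvPolynomial (Fin d) ℂ, H.IsAssociatedWith d π Q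

end CommHypergroup

/-!
Let `P = ℂ[z₁, …, z_d]`. The polynomials `Q x` form a basis of `P`, so a function `h` on `X` is the
same thing as a functional on `P`, namely `ℓ` with `ℓ (Q x) = h x`; by the linearization formula,
translation by `y` becomes multiplication by `Q y`. This uses that every function on `X` is
continuous: `X` is discrete, by Baire's theorem and cancellation in `P`
(`CommHypergroup.IsAssociatedWith.discreteTopology`). A variety is then stable under multiplication
by all of `P`, and a functional of the form `p ↦ α! · [t^α] p(φ(t))`, with `φ` a polynomial map, is a
moment function: the moment identities are the product rule for coefficients
(`CommHypergroup.IsAssociatedWith.isMomentFunction_of_isMomentFunctional`).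

It remains to see that a finite-dimensional space `W` of functionals that is stable under
multiplication by `P` is spanned by functionals of this form
(`MvPolynomial.mem_span_isMomentFunctional`). Multiplication by the coordinates gives commuting
operators on `W`, so `W` is the sum of their joint generalized eigenspaces. A functional `ℓ` in the
eigenspace with eigenvalues `χ` depends on finitely many Taylor coefficients at `χ`. If it is
nonzero, it generates the evaluation at `χ`, which therefore lies in `W` and is a moment functional;
so a multiple of it may be subtracted to get `ℓ 1 = 0`. Every such `ℓ` is a single moment functional.
Indeed, call `ℓ` a multilinear jet if it is the coefficient of `t₁ ⋯ t_r` in `p(φ(t))`. Taylor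
coefficients are multilinear jets, because differentiating amounts to adding one more parameter
(`MvPolynomial.IsMultilinearJet.comp_pderiv`), and multilinear jets at a common point are closed
under addition: parametrize by a product `S × T` of the two parameter sets and substitute
`∏ b, u_{ab}` for `t_a` and `∏ a, u_{ab}` for `s_b`, so that mixed terms are not squarefree
(`MvPolynomial.IsMultilinearJet.add`).
-/

namespace MvPolynomial

/-! ### Coefficients of squarefree top monomials -/

/-- The exponent `(1, …, 1)`. -/
noncomputable def allOnes (S : Type*) [Finite S] : S →₀ ℕ :=
  Finsupp.equivFunOnFinite.symm fun _ => 1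

@[simp]
theorem allOnes_apply (S : Type*) [Finite S] (s : S) : allOnes S s = 1 := rfl

theorem allOnes_ne_zero (S : Type*) [Finite S] [Nonempty S] : allOnes S ≠ 0 := by
  intro h
  obtain ⟨s⟩ := ‹Nonempty S›
  simpa using DFunLike.congr_fun h s

/-- The ideal generated by the squares of the variables. -/
noncomputable def squaresIdeal (S K : Type*) [CommRing K] : Ideal (MvPolynomial S K) :=
  Ideal.span (Set.range fun s : S => (X s : MvPolynomial S K) ^ 2)

theorem mem_squaresIdeal_of_X_sq_dvd {S K : Type*} [CommRing K] (s : S) {p : MvPolynomial S K}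
    (h : X s ^ 2 ∣ p) : p ∈ squaresIdeal S K :=
  Ideal.mem_of_dvd _ h (Ideal.subset_span ⟨s, rfl⟩)

theorem coeff_allOnes_of_mem_squaresIdeal {S K : Type*} [Finite S] [CommRing K]
    {p : MvPolynomial S K} (hp : p ∈ squaresIdeal S K) : coeff (allOnes S) p = 0 := by
  have h : squaresIdeal S K = Ideal.span ((fun m => monomial m (1 : K)) ''
      Set.range fun s : S => Finsupp.single s 2) := by
    rw [squaresIdeal, ← Set.range_comp]
    simp [Function.comp_def, X_pow_eq_monomial]
  rw [h, mem_ideal_span_monomial_image] at hp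
  by_contra hne
  obtain ⟨_, ⟨s, rfl⟩, hs⟩ := hp _ (mem_support_iff.2 hne)
  simpa using hs s

/-! ### Multilinear jets -/

variable {σ K : Type*} [Field K]

/-- A functional on polynomials is a multilinear jet with parameters `S` if it is the coefficient
of `∏ s, t_s` in `p(φ(t))` for a polynomial map `φ` in the parameters `t` with `φ(0) = 0`. The
substitution `p ↦ p(φ(t))` is encoded as an algebra homomorphism. -/
def IsMultilinearJet (S : Type*) [Finite S] (ℓ : Module.Dual K (MvPolynomial σ K)) : Prop :=
  ∃ Φ : MvPolynomial σ K →ₐ[K] MvPolynomial S K,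
    (∀ i, constantCoeff (Φ (X i)) = 0) ∧ ∀ p, ℓ p = coeff (allOnes S) (Φ p)

theorem constantCoeff_algHom {S : Type*} {Φ : MvPolynomial σ K →ₐ[K] MvPolynomial S K}
    (hΦ : ∀ i, constantCoeff (Φ (X i)) = 0) (p : MvPolynomial σ K) :
    constantCoeff (Φ p) = constantCoeff p := by
  induction p using MvPolynomial.induction_on with
  | C a => simp [algHom_C]
  | add p q hp hq => simp [hp, hq]
  | mul_X p i hp => simp [hΦ]

theorem isMultilinearJet_lcoeff_zero :
    IsMultilinearJet Empty (lcoeff K (0 : σ →₀ ℕ)) := by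
  refine ⟨aeval fun _ => 0, by simp, fun p => ?_⟩
  rw [Subsingleton.elim (allOnes Empty) 0]
  have := constantCoeff_algHom (Φ := aeval fun _ : σ => (0 : MvPolynomial Empty K)) (by simp) p
  simpa [constantCoeff_eq] using this.symm

theorem isMultilinearJet_zero (S : Type*) [Finite S] [Nonempty S] :
    IsMultilinearJet S (0 : Module.Dual K (MvPolynomial σ K)) := by
  classical
  refine ⟨aeval fun _ => 0, by simp, fun p => ?_⟩
  rw [aeval_zero', algebraMap_eq, coeff_C, if_neg (allOnes_ne_zero S).symm, LinearMap.zero_apply]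

/-- Rescaling one parameter. -/
theorem IsMultilinearJet.smul {S : Type*} [Finite S] [Nonempty S]
    {ℓ : Module.Dual K (MvPolynomial σ K)} (h : IsMultilinearJet S ℓ) (c : K) :
    IsMultilinearJet S (c • ℓ) := by
  classical
  obtain ⟨Φ, hΦ, hℓ⟩ := h
  obtain ⟨s₀⟩ := ‹Nonempty S›
  let Ψ : MvPolynomial S K →ₐ[K] MvPolynomial S K :=
    aeval fun s => C (if s = s₀ then c else 1) * X s
  have key : ∀ q, coeff (allOnes S) (Ψ q) = c * coeff (allOnes S) q := by
    intro q
    induction q using MvPolynomial.induction_on' with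
    | add p q hp hq => simp [hp, hq, mul_add]
    | monomial m a =>
      have : Ψ (monomial m a) = monomial m (a * c ^ m s₀) := by
        rw [aeval_monomial, algebraMap_eq]
        simp only [mul_pow]
        rw [Finsupp.prod_mul, monomial_eq, C_mul, mul_assoc]
        congr 2
        rw [Finsupp.prod]
        simp only [← C_pow, ite_pow, one_pow]
        rw [← map_prod, Finset.prod_ite_eq']
        by_cases hs : s₀ ∈ m.support
        · simp [hs]
        · simp [hs, Finsupp.notMem_support_iff.1 hs]
      rw [this, coeff_monomial, coeff_monomial]
      split_ifs with hm
      · simp [hm, mul_comm]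
      · simp
  refine ⟨Ψ.comp Φ, fun i => ?_, fun p => by simp [hℓ, key]⟩
  rw [AlgHom.comp_apply, constantCoeff_algHom (by simp [Ψ]), hΦ]

/-- Differentiation adds a parameter: to first order in `u`,
`p(φ(t) + u eᵢ) = p(φ(t)) + u (∂ᵢ p)(φ(t))`. -/
theorem IsMultilinearJet.comp_pderiv {S : Type*} [Finite S]
    {ℓ : Module.Dual K (MvPolynomial σ K)} (h : IsMultilinearJet S ℓ) (i : σ) :
    IsMultilinearJet (Option S) (ℓ ∘ₗ (pderiv (R := K) i).toLinearMap) := by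
  classical
  obtain ⟨Φ, hΦ, hℓ⟩ := h
  let ρ : MvPolynomial S K →ₐ[K] MvPolynomial (Option S) K := rename some
  let Ψ : MvPolynomial σ K →ₐ[K] MvPolynomial (Option S) K :=
    aeval fun j => ρ (Φ (X j)) + X none * ρ (Φ (pderiv i (X j)))
  have hΨ : ∀ j, constantCoeff (Ψ (X j)) = 0 := fun j => by simp [Ψ, ρ, hΦ]
  have key : ∀ p, Ψ p - (ρ (Φ p) + X none * ρ (Φ (pderiv i p))) ∈ squaresIdeal (Option S) K := by
    intro p
    induction p using MvPolynomial.induction_on with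
    | C a =>
      simp [algHom_C]
    | add p q hp hq =>
      convert Ideal.add_mem _ hp hq using 1
      simp only [map_add]
      ring
    | mul_X p j hp =>
      have hX : Ψ (X j) = ρ (Φ (X j)) + X none * ρ (Φ (pderiv i (X j))) := by simp [Ψ]
      have hsq : (X none : MvPolynomial (Option S) K) ^ 2 ∈ squaresIdeal (Option S) K :=
        mem_squaresIdeal_of_X_sq_dvd none dvd_rfl
      convert Ideal.add_mem _ (Ideal.mul_mem_right (Ψ (X j)) _ hp)
        (Ideal.mul_mem_left _ (ρ (Φ (pderiv i p)) * ρ (Φ (pderiv i (X j)))) hsq) using 1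
      rw [pderiv_mul]
      simp only [map_add, map_mul, hX]
      ring
  have hones : allOnes (Option S) - Finsupp.single none 1 = (allOnes S).mapDomain some := by
    ext (_ | s)
    · rw [Finsupp.mapDomain_of_notMem_range _ _ (by simp)]
      simp
    · rw [Finsupp.mapDomain_apply (Option.some_injective S)]
      simp
  refine ⟨Ψ, hΨ, fun p => ?_⟩
  have h0 := coeff_allOnes_of_mem_squaresIdeal (key p)
  rw [coeff_sub, coeff_add, coeff_X_mul', if_pos (by simp), hones,
    coeff_rename_mapDomain _ (Option.some_injective S), coeff_rename_eq_zero, zero_add,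
    sub_eq_zero] at h0
  · rw [h0, LinearMap.comp_apply, hℓ]
    rfl
  · intro u hu
    have := DFunLike.congr_fun hu none
    rw [Finsupp.mapDomain_of_notMem_range _ _ (by simp)] at this
    simp at this

/-- Merging two families of parameters: on `S × T`, substitute `∏ b, u_{ab}` for `t_a` and
`∏ a, u_{ab}` for `s_b`. Every mixed product `t_a s_b` is then divisible by `u_{ab}²`, so that only
the sum of the two coefficients survives. -/
theorem IsMultilinearJet.add {S T : Type*} [Finite S] [Finite T] [Nonempty S] [Nonempty T]
    {ℓ ℓ' : Module.Dual K (MvPolynomial σ K)}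
    (h : IsMultilinearJet S ℓ) (h' : IsMultilinearJet T ℓ') :
    IsMultilinearJet (S × T) (ℓ + ℓ') := by
  classical
  cases nonempty_fintype S
  cases nonempty_fintype T
  obtain ⟨Φ₁, hΦ₁, hℓ₁⟩ := h
  obtain ⟨Φ₂, hΦ₂, hℓ₂⟩ := h'
  let ψ₁ : MvPolynomial S K →ₐ[K] MvPolynomial (S × T) K := aeval fun a => ∏ b, X (a, b)
  let ψ₂ : MvPolynomial T K →ₐ[K] MvPolynomial (S × T) K := aeval fun b => ∏ a, X (a, b)
  have htop₁ : ∀ q, coeff (allOnes (S × T)) (ψ₁ q) = coeff (allOnes S) q := by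
    intro q
    induction q using MvPolynomial.induction_on' with
    | add p q hp hq => simp [hp, hq]
    | monomial m c =>
      have : ψ₁ (monomial m c) =
          monomial (Finsupp.equivFunOnFinite.symm fun u : S × T => m u.1) c := by
        simp only [ψ₁, monomial_eq]
        rw [Finsupp.prod_fintype _ _ (by simp), Finsupp.prod_fintype _ _ (by simp),
          Fintype.prod_prod_type]
        simp [Finset.prod_pow]
      rw [this, coeff_monomial, coeff_monomial]
      congr 1
      simp only [eq_iff_iff, DFunLike.ext_iff]
      simp
  have htop₂ : ∀ q, coeff (allOnes (S × T)) (ψ₂ q) = coeff (allOnes T) q := by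
    intro q
    induction q using MvPolynomial.induction_on' with
    | add p q hp hq => simp [hp, hq]
    | monomial m c =>
      have : ψ₂ (monomial m c) =
          monomial (Finsupp.equivFunOnFinite.symm fun u : S × T => m u.2) c := by
        simp only [ψ₂, monomial_eq]
        rw [Finsupp.prod_fintype _ _ (by simp), Finsupp.prod_fintype _ _ (by simp),
          Fintype.prod_prod_type_right]
        simp [Finset.prod_pow]
      rw [this, coeff_monomial, coeff_monomial]
      congr 1
      simp only [eq_iff_iff, DFunLike.ext_iff]
      simp
  have hmix : ∀ q₁ q₂, constantCoeff q₁ = 0 → constantCoeff q₂ = 0 →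
      ψ₁ q₁ * ψ₂ q₂ ∈ squaresIdeal (S × T) K := by
    intro q₁ q₂ h₁ h₂
    have hle : ((idealOfVars S K).map ψ₁) * ((idealOfVars T K).map ψ₂) ≤
        squaresIdeal (S × T) K := by
      rw [Ideal.map_span, Ideal.map_span, Ideal.span_mul_span', Ideal.span_le]
      rintro _ ⟨_, ⟨_, ⟨a, rfl⟩, rfl⟩, _, ⟨_, ⟨b, rfl⟩, rfl⟩, rfl⟩
      refine mem_squaresIdeal_of_X_sq_dvd (a, b) ?_
      simp only [ψ₁, ψ₂, aeval_X]
      rw [sq]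
      exact mul_dvd_mul (Finset.dvd_prod_of_mem (fun b => X (a, b)) (Finset.mem_univ b))
        (Finset.dvd_prod_of_mem (fun a => X (a, b)) (Finset.mem_univ a))
    refine hle (Ideal.mul_mem_mul (Ideal.mem_map_of_mem ψ₁ ?_) (Ideal.mem_map_of_mem ψ₂ ?_)) <;>
    · rw [← pow_one (idealOfVars _ _), mem_pow_idealOfVars_iff]
      intro m hm
      rw [Nat.one_le_iff_ne_zero, Ne, Finsupp.degree_eq_zero_iff]
      rintro rfl
      exact mem_support_iff.1 hm ‹_›
  let Ψ : MvPolynomial σ K →ₐ[K] MvPolynomial (S × T) K :=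
    aeval fun j => ψ₁ (Φ₁ (X j)) + ψ₂ (Φ₂ (X j))
  -- The constant term occurs in both summands and is subtracted once.
  have key : ∀ p, Ψ p - (ψ₁ (Φ₁ p) + ψ₂ (Φ₂ p) - C (constantCoeff p)) ∈
      squaresIdeal (S × T) K := by
    intro p
    induction p using MvPolynomial.induction_on with
    | C a => simp [algHom_C]
    | add p q hp hq =>
      convert Ideal.add_mem _ hp hq using 1
      simp only [map_add]
      ring
    | mul_X p j hp =>
      have hX : Ψ (X j) = ψ₁ (Φ₁ (X j)) + ψ₂ (Φ₂ (X j)) := by simp [Ψ]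
      have h₁ := hmix (Φ₁ p - C (constantCoeff p)) (Φ₂ (X j))
        (by simp [constantCoeff_algHom hΦ₁]) (hΦ₂ j)
      have h₂ := hmix (Φ₁ (X j)) (Φ₂ p - C (constantCoeff p)) (hΦ₁ j)
        (by simp [constantCoeff_algHom hΦ₂])
      convert Ideal.add_mem _ (Ideal.mul_mem_right (Ψ (X j)) _ hp) (Ideal.add_mem _ h₁ h₂) using 1
      simp only [map_mul, map_sub, hX, algHom_C, algebraMap_eq, constantCoeff_X, mul_zero, map_zero]
      ring
  refine ⟨Ψ, fun j => ?_, fun p => ?_⟩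
  · have h₁ := constantCoeff_algHom (Φ := ψ₁) (fun a => by simp [ψ₁]) (Φ₁ (X j))
    have h₂ := constantCoeff_algHom (Φ := ψ₂) (fun b => by simp [ψ₂]) (Φ₂ (X j))
    simp [Ψ, h₁, h₂, hΦ₁, hΦ₂]
  · have h0 := coeff_allOnes_of_mem_squaresIdeal (key p)
    rw [coeff_sub, coeff_sub, coeff_add, htop₁, htop₂, coeff_C,
      if_neg (allOnes_ne_zero _).symm, sub_zero, sub_eq_zero] at h0
    rw [h0, LinearMap.add_apply, hℓ₁, hℓ₂]

/-! ### Functionals supported at a point -/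

/-- The coefficient functionals are multilinear jets, as they are, up to nonzero factors, iterated
derivatives at the origin. The constant coefficient, for which `S` is empty, starts the induction. -/
theorem exists_isMultilinearJet_lcoeff [CharZero K] (γ : σ →₀ ℕ) :
    ∃ (S : Type) (_ : Finite S), (γ ≠ 0 → Nonempty S) ∧ IsMultilinearJet S (lcoeff K γ) := by
  classical
  induction h : γ.degree generalizing γ with
  | zero =>
    obtain rfl := (Finsupp.degree_eq_zero_iff γ).1 h
    exact ⟨Empty, inferInstance, fun h => (h rfl).elim, isMultilinearJet_lcoeff_zero⟩
  | succ n ih =>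
    obtain ⟨i, hi⟩ : ∃ i, γ i ≠ 0 := by
      by_contra! h0
      simp [show γ = 0 from Finsupp.ext h0] at h
    obtain ⟨m, rfl⟩ := exists_add_of_le
      (show Finsupp.single i 1 ≤ γ by simpa [Nat.one_le_iff_ne_zero] using hi)
    rw [add_comm] at h ⊢
    obtain ⟨S, _, -, hS⟩ := ih m (by simpa using h)
    refine ⟨Option S, inferInstance, fun _ => inferInstance, ?_⟩
    have hm : (m i + 1 : K) ≠ 0 := Nat.cast_add_one_ne_zero _
    convert (hS.comp_pderiv i).smul ((m i + 1 : K)⁻¹) using 1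
    refine LinearMap.ext fun p => ?_
    simp only [lcoeff_apply, LinearMap.smul_apply, LinearMap.comp_apply, smul_eq_mul]
    change _ = _ * coeff m (pderiv i p)
    rw [coeff_pderiv]
    field_simp

/-- A functional that vanishes at `1` and on all but finitely many monomials is a single
multilinear jet. -/
theorem exists_isMultilinearJet [CharZero K] {ℓ : Module.Dual K (MvPolynomial σ K)}
    (h1 : ℓ 1 = 0) (hfin : {γ | ℓ (monomial γ 1) ≠ 0}.Finite) :
    ∃ (S : Type) (_ : Finite S) (_ : Nonempty S), IsMultilinearJet S ℓ := by
  classical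
  have hsum : ℓ = ∑ γ ∈ hfin.toFinset, ℓ (monomial γ 1) • lcoeff K γ := by
    refine (basisMonomials σ K).ext fun γ => ?_
    simp only [coe_basisMonomials, LinearMap.sum_apply, LinearMap.smul_apply, lcoeff_apply,
      coeff_monomial, smul_eq_mul, mul_ite, mul_one, mul_zero, Finset.sum_ite_eq]
    simp +contextual
  rw [hsum]
  refine Finset.sum_induction _
    (fun ℓ => ∃ (S : Type) (_ : Finite S) (_ : Nonempty S), IsMultilinearJet S ℓ) ?_ ?_ ?_
  · rintro ℓ ℓ' ⟨S, _, _, h⟩ ⟨T, _, _, h'⟩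
    exact ⟨S × T, inferInstance, inferInstance, h.add h'⟩
  · exact ⟨Unit, inferInstance, inferInstance, isMultilinearJet_zero Unit⟩
  · intro γ hγ
    have hγ0 : γ ≠ 0 := by
      rintro rfl
      simp [h1] at hγ
    obtain ⟨S, _, hS, h⟩ := exists_isMultilinearJet_lcoeff (K := K) γ
    have := hS hγ0
    exact ⟨S, inferInstance, this, h.smul _⟩

/-- A nonzero functional that vanishes on all but finitely many monomials generates, as a module
over the polynomials, the evaluation at the origin. -/
theorem exists_mul_eq_constantCoeff {ℓ : Module.Dual K (MvPolynomial σ K)} (hℓ : ℓ ≠ 0)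
    (hfin : {γ | ℓ (monomial γ 1) ≠ 0}.Finite) :
    ∃ q, ∀ p, ℓ (q * p) = constantCoeff p := by
  classical
  have hne : hfin.toFinset.Nonempty := by
    by_contra h
    rw [Finset.not_nonempty_iff_eq_empty] at h
    refine hℓ ((basisMonomials σ K).ext fun γ => ?_)
    by_contra hγ
    have : γ ∈ hfin.toFinset := by simpa using hγ
    simp [h] at this
  -- For `γ` of maximal degree with `ℓ (X ^ γ) ≠ 0`, the functional `p ↦ ℓ (X ^ γ * p)` only sees the
  -- constant coefficient.
  obtain ⟨γ, hγ, hmax⟩ := hfin.toFinset.exists_max_image Finsupp.degree hne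
  rw [Set.Finite.mem_toFinset, Set.mem_ofPred_eq] at hγ
  refine ⟨monomial γ (ℓ (monomial γ 1))⁻¹, fun p => ?_⟩
  induction p using MvPolynomial.induction_on' with
  | add p q hp hq => simp [mul_add, hp, hq]
  | monomial m a =>
    have : ∀ (m : σ →₀ ℕ) (a : K), ℓ (monomial m a) = a * ℓ (monomial m 1) := fun m a => by
      rw [← smul_eq_mul, ← map_smul, smul_monomial, smul_eq_mul, mul_one]
    rw [monomial_mul, this, constantCoeff_monomial]
    split_ifs with hm
    · subst hm
      rw [add_zero]
      field_simp
    · by_contra hne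
      have h := hmax (γ + m) (by simpa using right_ne_zero_of_mul hne)
      rw [map_add] at h
      exact hm ((Finsupp.degree_eq_zero_iff m).1 (by omega))

/-- A functional on polynomials of the form `p ↦ α! · [t^α] p(φ(t))` for a polynomial map `φ` in
`r ≥ 1` parameters `t`; the substitution `p ↦ p(φ(t))` is encoded as an algebra homomorphism. -/
def IsMomentFunctional (ℓ : Module.Dual K (MvPolynomial σ K)) : Prop :=
  ∃ r : ℕ, 0 < r ∧ ∃ (Φ : MvPolynomial σ K →ₐ[K] MvPolynomial (Fin r) K) (α : Fin r →₀ ℕ),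
    ∀ p, ℓ p = ((∏ i, (α i).factorial : ℕ) : K) * coeff α (Φ p)

theorem IsMultilinearJet.isMomentFunctional_comp {S : Type*} [Finite S] [Nonempty S]
    {ℓ : Module.Dual K (MvPolynomial σ K)} (h : IsMultilinearJet S ℓ)
    (τ : MvPolynomial σ K →ₐ[K] MvPolynomial σ K) :
    IsMomentFunctional (ℓ ∘ₗ τ.toLinearMap) := by
  obtain ⟨Φ, -, hℓ⟩ := h
  let e := Finite.equivFin S
  refine ⟨Nat.card S, Nat.card_pos, (rename e).comp (Φ.comp τ), (allOnes S).mapDomain e,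
    fun p => ?_⟩
  have hα : ∀ i, (allOnes S).mapDomain e i = 1 := fun i => by
    rw [← e.apply_symm_apply i, Finsupp.mapDomain_apply e.injective, allOnes_apply]
  simp only [AlgHom.comp_apply, coeff_rename_mapDomain _ e.injective, hα, ← hℓ]
  simp

theorem isMomentFunctional_eval (z : σ → K) :
    IsMomentFunctional (aeval z : MvPolynomial σ K →ₐ[K] K).toLinearMap := by
  refine ⟨1, one_pos, (Algebra.ofId K _).comp (aeval z), 0, fun p => ?_⟩
  simp [Algebra.ofId_apply]

/-! ### Finite-dimensional modules of functionals -/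

theorem iSup_iInf_maxGenEigenspace_eq_top_of_commute [IsAlgClosed K] {W : Type*} [AddCommGroup W]
    [Module K W] [FiniteDimensional K W] (M : σ → Module.End K W)
    (h : ∀ i j, Commute (M i) (M j)) :
    ⨆ χ : σ → K, ⨅ i, (M i).maxGenEigenspace (χ i) = ⊤ :=
  Module.End.iSup_iInf_maxGenEigenspace_eq_top_of_iSup_maxGenEigenspace_eq_top_of_commute M
    (fun i j _ => h i j) fun i => Module.End.iSup_maxGenEigenspace_eq_top (M i)

/-- A finite-dimensional space of functionals, given as the range of `j`, that is stable under
multiplication by polynomials is spanned by moment functionals. -/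
theorem mem_span_isMomentFunctional [CharZero K] [IsAlgClosed K] [Finite σ] {W : Type*}
    [AddCommGroup W] [Module K W] [FiniteDimensional K W]
    (j : W →ₗ[K] Module.Dual K (MvPolynomial σ K))
    (hj : Function.Injective j) (M : MvPolynomial σ K → Module.End K W)
    (hM : ∀ q w p, j (M q w) p = j w (q * p)) (w : W) :
    j w ∈ Submodule.span K {ℓ | IsMomentFunctional ℓ ∧ ℓ ∈ LinearMap.range j} := by
  classical
  have htop : ⨆ χ : σ → K, ⨅ i, (M (X i)).maxGenEigenspace (χ i) = ⊤ := by
    refine iSup_iInf_maxGenEigenspace_eq_top_of_commute _ fun i k => ?_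
    refine LinearMap.ext fun v => hj (LinearMap.ext fun p => ?_)
    simp only [Module.End.mul_apply, hM]
    rw [mul_left_comm]
  suffices hle : (⨆ χ : σ → K, ⨅ i, (M (X i)).maxGenEigenspace (χ i)) ≤
      (Submodule.span K {ℓ | IsMomentFunctional ℓ ∧ ℓ ∈ LinearMap.range j}).comap j by
    rw [htop] at hle
    exact hle (Submodule.mem_top : w ∈ ⊤)
  refine iSup_le fun χ v hv => ?_
  rw [Submodule.mem_comap]
  -- The point `χ` is moved to the origin by the translation `τ`, with inverse `τ'`.
  let τ : MvPolynomial σ K →ₐ[K] MvPolynomial σ K := aeval fun i => X i + C (χ i)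
  let τ' : MvPolynomial σ K →ₐ[K] MvPolynomial σ K := aeval fun i => X i - C (χ i)
  have hττ' : ∀ p, τ (τ' p) = p := fun p => by
    rw [← AlgHom.comp_apply, ← AlgHom.id_apply (R := K) p]
    congr 1
    ext1 i
    simp [τ, τ']
  have hτ'τ : ∀ p, τ' (τ p) = p := fun p => by
    rw [← AlgHom.comp_apply, ← AlgHom.id_apply (R := K) p]
    congr 1
    ext1 i
    simp [τ, τ']
  have hpow : ∀ i, ∃ n : ℕ, ∀ p, j v ((X i - C (χ i)) ^ n * p) = 0 := by
    intro i
    obtain ⟨n, hn⟩ := (Module.End.mem_maxGenEigenspace _ _ _).1 ((Submodule.mem_iInf _).1 hv i)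
    have hshift : ∀ (n : ℕ) (w : W) p,
        j (((M (X i) - χ i • (1 : Module.End K W)) ^ n) w) p = j w ((X i - C (χ i)) ^ n * p) := by
      intro n
      induction n with
      | zero => simp
      | succ n ih =>
        intro w p
        rw [pow_succ, Module.End.mul_apply, ih, pow_succ, mul_comm _ (X i - C (χ i)), mul_assoc]
        simp [hM, sub_mul, C_mul']
    exact ⟨n, fun p => by simp [← hshift, hn]⟩
  choose n hn using hpow
  let ℓ : Module.Dual K (MvPolynomial σ K) := j v ∘ₗ τ'.toLinearMap
  have hv : j v = ℓ ∘ₗ τ.toLinearMap := LinearMap.ext fun p => by simp [ℓ, hτ'τ]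
  have hfin : {γ | ℓ (monomial γ 1) ≠ 0}.Finite := by
    refine (Set.finite_Iic (Finsupp.equivFunOnFinite.symm n)).subset fun γ hγ i => ?_
    by_contra! hi
    refine hγ ?_
    obtain ⟨m, rfl⟩ := exists_add_of_le (show Finsupp.single i (n i) ≤ γ by simpa using hi.le)
    rw [monomial_single_add]
    simp [ℓ, τ', hn]
  by_cases h1 : ℓ 1 = 0
  · obtain ⟨S, _, _, h⟩ := exists_isMultilinearJet h1 hfin
    refine Submodule.subset_span ⟨?_, ⟨v, rfl⟩⟩
    rw [hv]
    exact h.isMomentFunctional_comp τ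
  · -- Evaluation at `χ` lies in the range of `j`; removing its multiple leaves a single jet.
    let ε : Module.Dual K (MvPolynomial σ K) := (aeval χ : MvPolynomial σ K →ₐ[K] K).toLinearMap
    have hε : ε = lcoeff K 0 ∘ₗ τ.toLinearMap := by
      have : aeval χ = (aeval fun _ => (0 : K) : MvPolynomial σ K →ₐ[K] K).comp τ := by
        ext i
        simp [τ]
      refine LinearMap.ext fun p => ?_
      change aeval χ p = coeff 0 (τ p)
      rw [this, AlgHom.comp_apply, aeval_zero', constantCoeff_eq]
      rfl
    have hεV : ε ∈ LinearMap.range j := by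
      obtain ⟨q, hq⟩ := exists_mul_eq_constantCoeff (fun h => h1 (by simp [h])) hfin
      refine ⟨M (τ' q) v, ?_⟩
      rw [hε]
      refine LinearMap.ext fun p => ?_
      have := hq (τ p)
      simp only [ℓ, LinearMap.comp_apply, AlgHom.toLinearMap_apply, map_mul, hτ'τ] at this
      rw [hM, this]
      rfl
    have hsub : ((ℓ - ℓ 1 • lcoeff K 0) ∘ₗ τ.toLinearMap) = j v - ℓ 1 • ε := by
      rw [LinearMap.sub_comp, ← hv, LinearMap.smul_comp, ← hε]
    obtain ⟨S, _, _, h⟩ := exists_isMultilinearJet (ℓ := ℓ - ℓ 1 • lcoeff K 0) (by simp)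
      ((hfin.union (Set.finite_singleton 0)).subset fun γ hγ => by
        by_contra h
        simp only [Set.mem_union, Set.mem_ofPred_eq, Set.mem_singleton_iff, not_or,
          not_not] at h
        exact hγ (by simp [h.1, coeff_monomial, h.2]))
    have hmem := h.isMomentFunctional_comp τ
    rw [hsub] at hmem
    rw [← sub_add_cancel (j v) (ℓ 1 • ε)]
    exact add_mem (Submodule.subset_span ⟨hmem, sub_mem ⟨v, rfl⟩ (Submodule.smul_mem _ _ hεV)⟩)
      (Submodule.smul_mem _ _ (Submodule.subset_span ⟨isMomentFunctional_eval χ, hεV⟩))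

end MvPolynomial

namespace CommHypergroup

open MvPolynomial

/-! ### Polynomial hypergroups are discrete -/

theorem support_dirac {X : Type*} [TopologicalSpace X] [T1Space X] [MeasurableSpace X]
    [OpensMeasurableSpace X] (x : X) : (Measure.dirac x).support = {x} := by
  refine subset_antisymm ?_ ?_
  · exact Measure.support_subset_of_isClosed isClosed_singleton (by
      rw [mem_ae_iff, Measure.dirac_apply' _ (measurableSet_singleton x).compl]; simp)
  · rintro _ rfl
    refine Measure.mem_support_iff_forall _ |>.2 fun U hU => ?_
    rw [Measure.dirac_apply_of_mem (mem_of_mem_nhds hU)]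
    exact one_pos

variable {X : Type*} [TopologicalSpace X] [T2Space X] [LocallyCompactSpace X]
  [MeasurableSpace X] [BorelSpace X] {H : CommHypergroup X} {d : ℕ}
  {π : Measure (Fin d → ℂ)} {Q : X → MvPolynomial (Fin d) ℂ}

namespace IsAssociatedWith

theorem linearIndependent_all (hA : H.IsAssociatedWith d π Q) : LinearIndependent ℂ Q := by
  rw [← linearIndepOn_univ_iff]
  have : (Set.univ : Set X) = ⋃ n : ℕ, {x | (Q x).totalDegree ≤ n} :=
    (Set.eq_univ_of_forall fun x => Set.mem_iUnion.2 ⟨_, le_refl (Q x).totalDegree⟩).symm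
  rw [this]
  refine linearIndepOn_iUnion_of_directed (Monotone.directed_le fun m n hmn x hx => ?_)
    fun n => hA.linearIndependent n
  exact le_trans hx hmn

theorem top_le_span (hA : H.IsAssociatedWith d π Q) :
    ⊤ ≤ Submodule.span ℂ (Set.range Q) := by
  rintro p -
  have hp : p ∈ restrictTotalDegree (Fin d) ℂ p.totalDegree := by
    rw [mem_restrictTotalDegree]
  rw [← hA.span_eq] at hp
  exact Submodule.span_mono (Set.image_subset_range _ _) hp

/-- The polynomials `Q x` as a basis of the space of all polynomials. -/
noncomputable def basis (hA : H.IsAssociatedWith d π Q) :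
    Module.Basis X ℂ (MvPolynomial (Fin d) ℂ) :=
  Module.Basis.mk hA.linearIndependent_all hA.top_le_span

@[simp]
theorem basis_apply (hA : H.IsAssociatedWith d π Q) (x : X) : hA.basis x = Q x := by
  simp [basis]

theorem injective (hA : H.IsAssociatedWith d π Q) : Function.Injective Q :=
  hA.linearIndependent_all.injective

theorem ne_zero (hA : H.IsAssociatedWith d π Q) (x : X) : Q x ≠ 0 :=
  hA.linearIndependent_all.ne_zero x

theorem countable (hA : H.IsAssociatedWith d π Q) : Countable X := by
  have h := hA.basis.mk_eq_rank
  rw [MvPolynomial.rank_eq] at h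
  rw [← Cardinal.mk_le_aleph0_iff, ← Cardinal.lift_le_aleph0, h, Cardinal.lift_le_aleph0,
    Cardinal.mk_le_aleph0_iff]
  infer_instance

/-- If `δ_x * δ_y` is carried by the single point `x`, then `Q_x Q_y` is a multiple of `Q_x`, and
`Q_y = 1`. -/
theorem eq_one_of_support_subset (hA : H.IsAssociatedWith d π Q) {x y : X}
    (h : (H.conv x y : Measure X).support ⊆ {x}) : Q y = 1 := by
  obtain ⟨c, hc, hμ⟩ := hA.linearization x y
  have hsub : c.support ⊆ {x} := by
    intro w hw
    rw [Finset.mem_singleton]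
    refine h (Measure.mem_support_iff_forall _ |>.2 fun U hU => ?_)
    rw [hμ, Measure.finsetSum_apply]
    refine lt_of_lt_of_le ?_ (Finset.single_le_sum (fun _ _ => zero_le) hw)
    have hw' : c w ≠ 0 := Finsupp.mem_support_iff.1 hw
    rw [Measure.smul_apply, Measure.dirac_apply_of_mem (mem_of_mem_nhds hU)]
    simpa [pos_iff_ne_zero] using hw'
  have hx : Q x * Q y = C ((c x : ℝ) : ℂ) * Q x := by
    rw [hc]
    refine (Finset.sum_subset hsub fun w _ hw => ?_).trans (Finset.sum_singleton _ _)
    simp [Finsupp.notMem_support_iff.1 hw]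
  have hcx : ((c x : ℝ) : ℂ) = 1 := by
    have := congrArg (MvPolynomial.eval fun _ => (1 : ℂ)) hx
    simpa [hA.eval_one] using this.symm
  rw [hcx, C_1, one_mul] at hx
  exact mul_left_cancel₀ (hA.ne_zero x) (hx.trans (mul_one _).symm)

theorem support_conv_one (x : X) : (H.conv x H.one : Measure X).support = {x} := by
  rw [H.conv_comm, H.one_conv, support_dirac]

theorem apply_one (hA : H.IsAssociatedWith d π Q) : Q H.one = 1 :=
  hA.eq_one_of_support_subset (support_conv_one H.one).subset

/-- Being countable and locally compact, `X` has an isolated point `x` by Baire's theorem. The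
points `y` with `supp (δ_x * δ_y) ⊆ {x}` form an open set that reduces to the identity, and the
identity is isolated. Then so is every point, as `o ∈ supp (δ_x̌ * δ_y)` only for `y = x`. -/
theorem discreteTopology (hA : H.IsAssociatedWith d π Q) : DiscreteTopology X := by
  have := hA.countable
  have : Nonempty X := ⟨H.one⟩
  obtain ⟨x₀, hx₀⟩ : ∃ x : X, IsOpen ({x} : Set X) := by
    obtain ⟨x, y, hy⟩ := nonempty_interior_of_iUnion_of_closed (f := fun x : X => ({x} : Set X))
      (fun x => isClosed_singleton) (Set.iUnion_of_singleton X)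
    have hyx : y ∈ ({x} : Set X) := interior_subset hy
    obtain rfl := Set.mem_singleton_iff.1 hyx
    exact ⟨y, interior_eq_iff_isOpen.1
      (subset_antisymm interior_subset (Set.singleton_subset_iff.2 hy))⟩
  -- Cancellation of `Q x₀` shows that only `o` stabilizes `x₀`.
  have hone : IsOpen ({H.one} : Set X) := by
    have h := (H.isOpen_support_subset _ hx₀).preimage (Continuous.prodMk_right x₀)
    convert h using 1
    ext y
    refine ⟨?_, fun hy => hA.injective ?_⟩
    · rintro rfl
      exact (support_conv_one x₀).subset
    · rw [hA.apply_one, hA.eq_one_of_support_subset hy]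
  rw [discreteTopology_iff_isOpen_singleton]
  intro x
  have h := (H.isOpen_support_inter _ hone).preimage (Continuous.prodMk_right (H.inv x))
  convert h using 1
  ext y
  have hinj : Function.Injective H.inv := Function.LeftInverse.injective H.inv_inv
  simp [H.one_mem_support_iff, hinj.eq_iff, eq_comm]

/-! ### Functions as functionals on polynomials -/

/-- A function `h` on `X` corresponds to the functional `ℓ` on polynomials with `ℓ (Q x) = h x`.
As `X` is discrete, every functional arises. -/
noncomputable def dualEquiv (hA : H.IsAssociatedWith d π Q) :
    C(X, ℂ) ≃ₗ[ℂ] Module.Dual ℂ (MvPolynomial (Fin d) ℂ) where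
  toFun h := hA.basis.constr ℂ h
  invFun ℓ :=
    haveI := hA.discreteTopology
    ⟨fun x => ℓ (Q x), continuous_of_discreteTopology⟩
  map_add' g h := by rw [ContinuousMap.coe_add, map_add]
  map_smul' c h := by rw [ContinuousMap.coe_smul, map_smul, RingHom.id_apply]
  left_inv h := by
    ext x
    simp [← hA.basis_apply, -basis_apply, Module.Basis.constr_basis]
  right_inv ℓ := hA.basis.ext fun x => by
    rw [Module.Basis.constr_basis]
    simp

theorem dualEquiv_apply_Q (hA : H.IsAssociatedWith d π Q) (h : C(X, ℂ)) (x : X) :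
    hA.dualEquiv h (Q x) = h x := by
  rw [← hA.basis_apply x]
  exact hA.basis.constr_basis ℂ _ x

@[simp]
theorem dualEquiv_symm_apply (hA : H.IsAssociatedWith d π Q)
    (ℓ : Module.Dual ℂ (MvPolynomial (Fin d) ℂ)) (x : X) :
    hA.dualEquiv.symm ℓ x = ℓ (Q x) := rfl

/-- Translation by `y` corresponds to multiplication by `Q y`. -/
theorem eval_eq_dualEquiv (hA : H.IsAssociatedWith d π Q) (h : C(X, ℂ)) (x y : X) :
    H.eval h x y = hA.dualEquiv h (Q x * Q y) := by
  obtain ⟨c, hc, hμ⟩ := hA.linearization x y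
  rw [eval, hc, hμ, integral_finsetSum_measure, map_sum]
  · refine Finset.sum_congr rfl fun w _ => ?_
    rw [C_mul', map_smul, dualEquiv_apply_Q, integral_smul_measure, integral_dirac]
    simp
  · intro w _
    exact (integrable_dirac (by simp)).smul_measure (by simp)

/-- The coefficients of a polynomial substitution form a moment sequence, since
`α! = (α.choose β) β! (α - β)!`. -/
theorem isMomentFunction_of_isMomentFunctional (hA : H.IsAssociatedWith d π Q) {g : C(X, ℂ)}
    (hg : IsMomentFunctional (hA.dualEquiv g)) : H.IsMomentFunction g := by
  classical
  obtain ⟨r, hr, Φ, α, hα⟩ := hg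
  let F : (Fin r → ℕ) → Module.Dual ℂ (MvPolynomial (Fin d) ℂ) := fun a =>
    ((∏ i, (a i).factorial : ℕ) : ℂ) •
      (lcoeff ℂ (Finsupp.equivFunOnFinite.symm a) ∘ₗ Φ.toLinearMap)
  have hF : ∀ a p, F a p = ((∏ i, (a i).factorial : ℕ) : ℂ) *
      coeff (Finsupp.equivFunOnFinite.symm a) (Φ p) := fun a p => rfl
  refine ⟨r, hr, fun a => hA.dualEquiv.symm (F a), ⟨?_, ?_⟩, α, ?_⟩
  · intro h
    have h1 := DFunLike.congr_fun h H.one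
    rw [dualEquiv_symm_apply, hF, hA.apply_one, map_one] at h1
    have h0 : (Finsupp.equivFunOnFinite.symm (0 : Fin r → ℕ)) = 0 := by
      ext
      simp
    rw [h0, coeff_zero_one] at h1
    simp at h1
  · intro a x y
    rw [hA.eval_eq_dualEquiv, LinearEquiv.apply_symm_apply, hF, map_mul, coeff_mul, Finset.mul_sum]
    refine Finset.sum_nbij' (fun u => u.1) (fun b => (Finsupp.equivFunOnFinite.symm b,
      Finsupp.equivFunOnFinite.symm (a - b))) ?_ ?_ ?_ ?_ ?_
    · rintro ⟨u, v⟩ huv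
      rw [Finset.HasAntidiagonal.mem_antidiagonal] at huv
      rw [Finset.mem_Iic]
      intro i
      have := DFunLike.congr_fun huv i
      simp at this
      simp only
      omega
    · intro b hb
      rw [Finset.mem_Iic] at hb
      rw [Finset.HasAntidiagonal.mem_antidiagonal]
      ext i
      have : b i ≤ a i := hb i
      simp
      omega
    · rintro ⟨u, v⟩ huv
      rw [Finset.HasAntidiagonal.mem_antidiagonal] at huv
      ext i
      · simp
      · have := DFunLike.congr_fun huv i
        simp at this
        simp
        omega
    · intro b _
      simp
    · rintro ⟨u, v⟩ huv
      rw [Finset.HasAntidiagonal.mem_antidiagonal] at huv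
      have huv' : ∀ i, u i + v i = a i := fun i => by
        simpa using DFunLike.congr_fun huv i
      have hv : Finsupp.equivFunOnFinite.symm (a - ⇑u) = v := by
        ext i
        have := huv' i
        simp
        omega
      have hfact : ∏ i, (a i).factorial = (∏ i, (a i).choose (u i)) * (∏ i, (u i).factorial) *
          ∏ i, ((a - ⇑u) i).factorial := by
        rw [← Finset.prod_mul_distrib, ← Finset.prod_mul_distrib]
        refine Finset.prod_congr rfl fun i _ => ?_
        rw [Pi.sub_apply, Nat.choose_mul_factorial_mul_factorial (by have := huv' i; omega)]
      simp only [dualEquiv_symm_apply, hF, hv, hfact, Finsupp.equivFunOnFinite_symm_coe]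
      push_cast
      ring
  · refine hA.dualEquiv.injective (LinearMap.ext fun p => ?_)
    rw [LinearEquiv.apply_symm_apply, hF, hα, Finsupp.equivFunOnFinite_symm_coe]

/-! ### Varieties -/

/-- Multiplication by the polynomial `q`, as an operator on functions on `X`. -/
noncomputable def mulOp (hA : H.IsAssociatedWith d π Q) (q : MvPolynomial (Fin d) ℂ) :
    Module.End ℂ C(X, ℂ) :=
  hA.dualEquiv.symm.toLinearMap ∘ₗ (LinearMap.mulLeft ℂ q).dualMap ∘ₗ hA.dualEquiv.toLinearMap

theorem mulOp_apply (hA : H.IsAssociatedWith d π Q) (q : MvPolynomial (Fin d) ℂ) (h : C(X, ℂ))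
    (x : X) : hA.mulOp q h x = hA.dualEquiv h (q * Q x) := rfl

theorem dualEquiv_mulOp (hA : H.IsAssociatedWith d π Q) (q p : MvPolynomial (Fin d) ℂ)
    (h : C(X, ℂ)) : hA.dualEquiv (hA.mulOp q h) p = hA.dualEquiv h (q * p) := by
  simp [mulOp]

theorem mulOp_mem_variety (hA : H.IsAssociatedWith d π Q) (f : C(X, ℂ))
    (q : MvPolynomial (Fin d) ℂ) {h : C(X, ℂ)} (hh : h ∈ H.variety f) :
    hA.mulOp q h ∈ H.variety f := by
  rw [variety, Submodule.mem_sInf] at hh ⊢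
  intro V hV
  have hq := hA.top_le_span (Submodule.mem_top : q ∈ ⊤)
  induction hq using Submodule.span_induction with
  | mem q hq =>
    obtain ⟨y, rfl⟩ := hq
    obtain ⟨g, hg, hgy⟩ := hV.1.translate_mem h (hh V hV) y
    convert hg using 1
    ext x
    rw [mulOp_apply, hgy, hA.eval_eq_dualEquiv, mul_comm]
  | zero =>
    convert V.zero_mem using 1
    ext x
    simp [mulOp_apply]
  | add p q _ _ hp hq =>
    convert V.add_mem hp hq using 1
    ext x
    simp [mulOp_apply, add_mul]
  | smul c q _ hq =>
    convert V.smul_mem c hq using 1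
    ext x
    simp [mulOp_apply]

theorem mem_span_isMomentFunction (hA : H.IsAssociatedWith d π Q) {f : C(X, ℂ)}
    (hf : H.IsExponentialPolynomial f) :
    f ∈ Submodule.span ℂ {g : C(X, ℂ) | H.IsMomentFunction g ∧ g ∈ H.variety f} := by
  have : FiniteDimensional ℂ (H.variety f) := hf
  have hfV : f ∈ H.variety f := by
    rw [variety, Submodule.mem_sInf]
    exact fun V hV => hV.2
  let W : Submodule ℂ C(X, ℂ) := H.variety f
  let j : W →ₗ[ℂ] Module.Dual ℂ (MvPolynomial (Fin d) ℂ) := hA.dualEquiv.toLinearMap ∘ₗ W.subtype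
  let M : MvPolynomial (Fin d) ℂ → Module.End ℂ W := fun q =>
    (hA.mulOp q).restrict fun _ hg => hA.mulOp_mem_variety f q hg
  have hj : Function.Injective j := hA.dualEquiv.injective.comp Subtype.val_injective
  have hM : ∀ q w p, j (M q w) p = j w (q * p) := fun q w p => hA.dualEquiv_mulOp q p w
  have h := mem_span_isMomentFunctional (W := W) j hj M hM ⟨f, hfV⟩
  let U : Submodule ℂ C(X, ℂ) :=
    Submodule.span ℂ {g : C(X, ℂ) | H.IsMomentFunction g ∧ g ∈ H.variety f}
  have hle : Submodule.span ℂ {ℓ | IsMomentFunctional ℓ ∧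
      ℓ ∈ LinearMap.range j} ≤
      U.comap hA.dualEquiv.symm.toLinearMap := by
    rw [Submodule.span_le]
    rintro _ ⟨hℓ, g, rfl⟩
    have hg : hA.dualEquiv.symm (j g) = g.1 := hA.dualEquiv.symm_apply_apply g.1
    change hA.dualEquiv.symm (j g) ∈ U
    rw [hg]
    exact Submodule.subset_span ⟨hA.isMomentFunction_of_isMomentFunctional hℓ, g.2⟩
  have hf' := hle h
  change hA.dualEquiv.symm (j ⟨f, hfV⟩) ∈ U at hf'
  rwa [show hA.dualEquiv.symm (j ⟨f, hfV⟩) = f from hA.dualEquiv.symm_apply_apply f] at hf'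

end IsAssociatedWith

end CommHypergroup

theorem corollary5p3 {X : Type*} [TopologicalSpace X] [T2Space X] [LocallyCompactSpace X]
    [MeasurableSpace X] [BorelSpace X] (H : CommHypergroup X)
    (hH : H.IsPolynomialHypergroup) :
    (∀ f : C(X, ℂ), H.IsExponentialPolynomial f →
      f ∈ Submodule.span ℂ {g : C(X, ℂ) | H.IsMomentFunction g ∧ g ∈ H.variety f}) ∧
    (∀ f : C(X, ℂ), H.IsExponentialMonomial f →
      f ∈ Submodule.span ℂ {g : C(X, ℂ) | H.IsMomentFunction g ∧ g ∈ H.variety f}) := by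
  obtain ⟨d, -, π, -, Q, hA⟩ := hH
  exact ⟨fun f hf => hA.mem_span_isMomentFunction hf,
    fun f hf => hA.mem_span_isMomentFunction hf.1⟩
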